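/- Let $0<m$, $L>0$, $0<\gamma<1/L$ and $C_0\ge 0$, and put $$\zeta=\sqrt{\max\Big\{\tfrac12,\;1-\tfrac m4\min\big\{\gamma,\tfrac1{4L}\big\}\Big\}} .$$ There is a constant $K$, depending only on $m,L,\gamma,C_0$, such that the following holds for every $n$, every $f:\mathbb R^n\times[0,\infty)\to\mathbb R$ and every closed, proper, convex $g:\mathbb R^n\to\mathbb R\cup\{+\infty\}$. Assume that for every $t\ge0$ the function $f(\cdot;t)$ is $m$-strongly convex, twice differentiable, and has an $L$-Lipschitz gradient, and that $t\mapsto\nabla_{x}f(x;t)$ is differentiable on $[0,\infty)$ with $\|\nabla_{tx}f(x;t)\|\le C_0$ for all $x$ and all $t\ge0$. Then for every $t\ge0$ the problem $\min_x\{f(x;t)+g(x)\}$ has a unique solution $x^*(t)$. Let $P,C\in\mathbb N$ satisfy $$\zeta^C\Big[\zeta^P+(\zeta^P+1)\,\frac{2L}{m}\,\frac{1-\gamma m}{1-\gamma L}\Big]<1 ,$$ let $T_s>0$, $t_0\ge0$, $t_k=t_0+kT_s$, and let $(x_k)_{k\in\mathbb N}$ be generated from an arbitrary $x_0\in\mathbb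 R^n$ by the prediction--correction algorithm below. Then $$\limsup_{k\to\infty}\|x_k-x^*(t_k)\|\le K\,\zeta^C\,T_s .$$ *Quasi-Newton step.* For a differentiable $\varphi:\mathbb R^n\to\mathbb R$, the forward--backward envelope of $\varphi+g$ is $$M_\varphi(x)=\inf_y\Big\{\varphi(x)+\langle\nabla\varphi(x),y-x\rangle+g(y)+\tfrac1{2\gamma}\|y-x\|^2\Big\}.$$ A quasi-Newton step from $x$ to $x'$ takes a nonsingular matrix $B$ (for instance the one given by BFGS) and the direction $d=-B^{-1}\nabla M_\varphi(x)$, chooses a step size $\tau\ge0$ such that $w=x+\tau d$ satisfies $M_\varphi(w)\le M_\varphi(x)$, and sets $x'=\operatorname{prox}_{\gamma g}(w-\gamma\nabla\varphi(w))$, where $\operatorname{prox}_{\gamma g}(v)=\arg\min_y\{g(y)+\frac1{2\gamma}\|y-v\|^2\}$. *Algorithm.* Given $x_k$, let $Q_k=\nabla_{xx}f(x_k;t_k)$ and $$h_k(x)=\tfrac12x^\top Q_kx+\big(\nabla_xf(x_k;t_k)-Q_kx_k+T_s\nabla_{tx}f(x_k;t_k)\big)^\top x .$$ Prediction: perform $P$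 quasi-Newton steps for $\varphi=h_k$ starting from $x_k$, reaching $\tilde x_{k+1|k}$. Correction: perform $C$ quasi-Newton steps for $\varphi=f(\cdot;t_{k+1})$ starting from $\tilde x_{k+1|k}$, reaching $x_{k+1}$. -/

import Mathlib

open Filter Set
open scoped RealInnerProductSpace

noncomputable section

/-- The space `ℝⁿ` with its Euclidean norm. -/
abbrev Euc (n : ℕ) : Type := EuclideanSpace ℝ (Fin n)

/-- The class `𝒮_{m,L}(ℝⁿ)`: `m`-strongly convex functions that are `L`-smooth, that is,
differentiable with an `L`-Lipschitz gradient. -/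
structure StronglyConvexSmooth {n : ℕ} (m L : ℝ) (φ : Euc n → ℝ) : Prop where
  strongConvex : StrongConvexOn Set.univ m φ
  differentiable : Differentiable ℝ φ
  lipschitz : ∀ x y, ‖gradient φ x - gradient φ y‖ ≤ L * ‖x - y‖

/-- The class `Γ₀(ℝⁿ)` of closed, proper, convex functions with values in `ℝ ∪ {+∞}`. -/
structure ClosedProperConvex {n : ℕ} (g : Euc n → EReal) : Prop where
  ne_bot : ∀ x, g x ≠ ⊥
  exists_ne_top : ∃ x, g x ≠ ⊤
  closed : ∀ a : ℝ, IsClosed {x | g x ≤ (a : EReal)}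
  convex : Convex ℝ {p : Euc n × ℝ | g p.1 ≤ (p.2 : EReal)}

/-- The gradient `∇ₓ f(x;t)` of `f(·;t)`. -/
def gradX {n : ℕ} (f : Euc n → ℝ → ℝ) (x : Euc n) (t : ℝ) : Euc n :=
  gradient (fun z => f z t) x

/-- The Hessian `∇ₓₓ f(x;t)` of `f(·;t)`, as a linear operator on `ℝⁿ`. -/
def hessX {n : ℕ} (f : Euc n → ℝ → ℝ) (x : Euc n) (t : ℝ) : Euc n →L[ℝ] Euc n :=
  fderiv ℝ (fun z => gradX f z t) x

/-- The time derivative `∇ₜₓ f(x;t)` of the gradient, time ranging over `[0,∞)`. -/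
def gradTX {n : ℕ} (f : Euc n → ℝ → ℝ) (x : Euc n) (t : ℝ) : Euc n :=
  derivWithin (fun s => gradX f x s) (Set.Ici 0) t

/-- `f(·;t)` belongs to `𝒮_{m,L}(ℝⁿ)` for every `t ≥ 0`, with the same `m` and `L`; the second
derivatives `∇ₓₓ f` and `∇ₜₓ f` exist, and the latter is bounded by `C₀`. -/
structure CostAssumptions {n : ℕ} (m L C₀ : ℝ) (f : Euc n → ℝ → ℝ) : Prop where
  stronglyConvexSmooth : ∀ t, 0 ≤ t → StronglyConvexSmooth m L (fun x => f x t)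
  differentiable_gradX : ∀ t, 0 ≤ t → Differentiable ℝ (fun x => gradX f x t)
  differentiableOn_time : ∀ x, DifferentiableOn ℝ (fun s => gradX f x s) (Set.Ici 0)
  norm_gradTX_le : ∀ x t, 0 ≤ t → ‖gradTX f x t‖ ≤ C₀

/-- `x` minimizes `φ + g` over `ℝⁿ`. -/
def IsMinimizer {n : ℕ} (φ : Euc n → ℝ) (g : Euc n → EReal) (x : Euc n) : Prop :=
  ∀ y, (φ x : EReal) + g x ≤ (φ y : EReal) + g y

/-- `p = prox_{γ g}(v)`: the point `p` minimizes `‖y - v‖² / (2γ) + g(y)`. -/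
def IsProx {n : ℕ} (g : Euc n → EReal) (γ : ℝ) (v p : Euc n) : Prop :=
  IsMinimizer (fun y => ‖y - v‖ ^ 2 / (2 * γ)) g p

/-- The forward-backward envelope of `φ + g`. -/
def fbe {n : ℕ} (φ : Euc n → ℝ) (g : Euc n → EReal) (γ : ℝ) (x : Euc n) : EReal :=
  ⨅ y, ((φ x + ⟪gradient φ x, y - x⟫ + ‖y - x‖ ^ 2 / (2 * γ) : ℝ) : EReal) + g y

/-- One step of the quasi-Newton method for the forward-backward envelope `M` of `φ + g`, from
`x` to `x'`: a direction `d = -B⁻¹ ∇M(x)` with `B` nonsingular, a step size `τ ≥ 0` such that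
`w = x + τ d` satisfies `M(w) ≤ M(x)`, then `x' = prox_{γ g}(w - γ ∇φ(w))`.
The matrix `B` and the step size `τ` are otherwise free, so every rule for computing them (such
as BFGS with any initialization) is covered. -/
def QuasiNewtonStep {n : ℕ} (φ : Euc n → ℝ) (g : Euc n → EReal) (γ : ℝ) (x x' : Euc n) : Prop :=
  ∃ (B : Euc n ≃L[ℝ] Euc n) (τ : ℝ) (d w : Euc n),
    0 ≤ τ ∧
    d = -(B.symm (gradient (fun z => (fbe φ g γ z).toReal) x)) ∧
    w = x + τ • d ∧
    fbe φ g γ w ≤ fbe φ g γ x ∧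
    IsProx g γ (w - γ • gradient φ w) x'

/-- `N` successive quasi-Newton steps lead from `x` to `x'`. -/
def QuasiNewtonSteps {n : ℕ} (φ : Euc n → ℝ) (g : Euc n → EReal) (γ : ℝ) (N : ℕ)
    (x x' : Euc n) : Prop :=
  ∃ u : ℕ → Euc n, u 0 = x ∧ u N = x' ∧ ∀ i < N, QuasiNewtonStep φ g γ (u i) (u (i + 1))

/-- The prediction model `h` built at the point `z` and time `t` with sampling period `Ts`:
`h(x) = ½ ⟨x, Q x⟩ + ⟨∇ₓ f(z;t) - Q z + Ts ∇ₜₓ f(z;t), x⟩` with `Q = ∇ₓₓ f(z;t)`. -/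
def predModel {n : ℕ} (f : Euc n → ℝ → ℝ) (Ts : ℝ) (z : Euc n) (t : ℝ) (x : Euc n) : ℝ :=
  1 / 2 * ⟪x, hessX f z t x⟫ + ⟪gradX f z t - hessX f z t z + Ts • gradTX f z t, x⟫

/-- `x` is a trajectory of the prediction-correction algorithm with sampling times
`t₀ + k Ts`: from `x k`, first `P` quasi-Newton steps on the envelope of the prediction problem
at time `t₀ + k Ts`, then `C` quasi-Newton steps on the envelope of the problem at time
`t₀ + (k + 1) Ts`. The initial point `x 0` is arbitrary. -/
def IsPredictionCorrection {n : ℕ} (f : Euc n → ℝ → ℝ) (g : Euc n → EReal) (γ : ℝ) (P C : ℕ)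
    (t₀ Ts : ℝ) (x : ℕ → Euc n) : Prop :=
  ∀ k : ℕ, ∃ xpred : Euc n,
    QuasiNewtonSteps (predModel f Ts (x k) (t₀ + k * Ts)) g γ P (x k) xpred ∧
    QuasiNewtonSteps (fun z => f z (t₀ + (k + 1) * Ts)) g γ C xpred (x (k + 1))

/-- The linear rate `ζ` of the quasi-Newton method. -/
def rateZeta (m L γ : ℝ) : ℝ :=
  Real.sqrt (max (1 / 2) (1 - m / 4 * min γ (1 / (4 * L))))

end

/-! The argument follows the cost gap `V k = F(x_k; t_k) - min F(·; t_k)`, with `F = f + g`, rather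
than the distance to the minimizer. Since `γ < 1/L`, the proximal step from `w` brings the cost
below `M(w) ≤ M(x)`, and `M(x)` is at most the forward-backward model at `x` evaluated anywhere. So
nothing about `B` or `τ` matters, and strong convexity makes each step contract the gap by `1 - γ m`
(`quasiNewtonStep_gap_le`).

Prediction is used only through the fact that it does not increase `h_k + g`. With `κ = L/m` and `c
= C₀ Ts`, this confines the predicted point near `x_k`, and its gap for the next cost is at most `18
κ² V k + 20 κ c²/m` (`prediction_gap_le`).

Bernoulli's inequality gives `1 - γ m ≤ ζ^8`, and the hypothesis on `P` and `C` forces `2 κ ζ^C <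
1`. This surplus of powers absorbs the factors of `κ`, so that `V (k+1) ≤ V k / 2 + ζ^(2C) c²/m`.
Hence the limsup of `V` is at most `2 ζ^(2C) c²/m`, and quadratic growth `(m/2) ‖x_k - x*‖² ≤ V k`
turns this into the distance bound with `K = 2 C₀ / m`. -/

/-! ### Inequalities for strongly convex and smooth functions -/

/-- First-order lower bound for a differentiable strongly convex function. -/
theorem StrongConvexOn.add_inner_gradient_le {n : ℕ} {m : ℝ} {φ : Euc n → ℝ}
    (hφ : StrongConvexOn univ m φ) (hd : Differentiable ℝ φ) (x y : Euc n) :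
    φ x + ⟪gradient φ x, y - x⟫ + m / 2 * ‖y - x‖ ^ 2 ≤ φ y := by
  have hline : HasDerivAt (fun s : ℝ => φ (x + s • (y - x))) ⟪gradient φ x, y - x⟫ 0 := by
    have h1 : HasDerivAt (fun s : ℝ => x + s • (y - x)) (y - x) 0 := by
      simpa using ((hasDerivAt_id (0 : ℝ)).smul_const (y - x)).const_add x
    have h2 : HasFDerivAt φ (fderiv ℝ φ x) (x + (0 : ℝ) • (y - x)) := by
      simpa using (hd x).hasFDerivAt
    simpa [inner_gradient_left, Function.comp_def] using h2.comp_hasDerivAt (0 : ℝ) h1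
  have hslope := hline.tendsto_slope_zero_right
  have hright : Tendsto (fun s : ℝ => φ y - φ x - m / 2 * (1 - s) * ‖y - x‖ ^ 2)
      (nhdsWithin 0 (Ioi 0)) (nhds (φ y - φ x - m / 2 * (1 - 0) * ‖y - x‖ ^ 2)) :=
    (Continuous.tendsto (by fun_prop) 0).mono_left nhdsWithin_le_nhds
  have hle := le_of_tendsto_of_tendsto hslope hright (by
    filter_upwards [Ioo_mem_nhdsGT (zero_lt_one' ℝ)] with s hs
    have h := hφ.2 (mem_univ x) (mem_univ y) (sub_nonneg.2 hs.2.le) hs.1.le (by ring)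
    have hpt : (1 - s) • x + s • y = x + s • (y - x) := by module
    rw [hpt, norm_sub_rev x y] at h
    simp only [smul_eq_mul, zero_add, zero_smul, add_zero] at h ⊢
    rw [inv_mul_le_iff₀ hs.1]
    linarith)
  linarith

/-- The descent inequality for a function with Lipschitz gradient. -/
theorem le_add_inner_gradient_add_of_lipschitz {n : ℕ} {L : ℝ} {φ : Euc n → ℝ}
    (hd : Differentiable ℝ φ) (hL : ∀ x y, ‖gradient φ x - gradient φ y‖ ≤ L * ‖x - y‖)
    (x y : Euc n) :
    φ y ≤ φ x + ⟪gradient φ x, y - x⟫ + L / 2 * ‖y - x‖ ^ 2 := by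
  have hline : ∀ s : ℝ, HasDerivAt (fun s : ℝ => φ (x + s • (y - x)))
      ⟪gradient φ (x + s • (y - x)), y - x⟫ s := by
    intro s
    have h1 : HasDerivAt (fun s : ℝ => x + s • (y - x)) (y - x) s := by
      simpa using ((hasDerivAt_id s).smul_const (y - x)).const_add x
    simpa [inner_gradient_left, Function.comp_def] using
      (hd (x + s • (y - x))).hasFDerivAt.comp_hasDerivAt s h1
  have hψ : ∀ s : ℝ, HasDerivAt (fun s : ℝ => φ (x + s • (y - x)) - s * ⟪gradient φ x, y - x⟫
      - L / 2 * ‖y - x‖ ^ 2 * s ^ 2)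
      (⟪gradient φ (x + s • (y - x)), y - x⟫ - ⟪gradient φ x, y - x⟫
        - L * ‖y - x‖ ^ 2 * s) s := by
    intro s
    have h := ((hline s).sub ((hasDerivAt_id s).mul_const ⟪gradient φ x, y - x⟫)).sub
      ((hasDerivAt_pow 2 s).const_mul (L / 2 * ‖y - x‖ ^ 2))
    exact h.congr_deriv (by push_cast; ring)
  -- The Lipschitz bound makes the derivative of the difference nonpositive on the segment;
  -- comparing the endpoints gives the claim.
  have hanti : AntitoneOn (fun s : ℝ => φ (x + s • (y - x)) - s * ⟪gradient φ x, y - x⟫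
      - L / 2 * ‖y - x‖ ^ 2 * s ^ 2) (Icc 0 1) := by
    refine antitoneOn_of_deriv_nonpos (convex_Icc 0 1)
      (fun s _ => (hψ s).continuousAt.continuousWithinAt)
      (fun s _ => (hψ s).differentiableAt.differentiableWithinAt) ?_
    intro s hs
    rw [interior_Icc] at hs
    rw [(hψ s).deriv, ← inner_sub_left]
    have h1 := real_inner_le_norm (gradient φ (x + s • (y - x)) - gradient φ x) (y - x)
    have h2 := hL (x + s • (y - x)) x
    rw [add_sub_cancel_left, norm_smul, Real.norm_eq_abs, abs_of_pos hs.1] at h2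
    nlinarith [mul_le_mul_of_nonneg_right h2 (norm_nonneg (y - x))]
  have h := hanti (left_mem_Icc.2 zero_le_one) (right_mem_Icc.2 zero_le_one) zero_le_one
  simp [-inner_gradient_left] at h
  linarith

theorem StronglyConvexSmooth.lower {n : ℕ} {m L : ℝ} {φ : Euc n → ℝ}
    (hφ : StronglyConvexSmooth m L φ) (x y : Euc n) :
    φ x + ⟪gradient φ x, y - x⟫ + m / 2 * ‖y - x‖ ^ 2 ≤ φ y :=
  hφ.strongConvex.add_inner_gradient_le hφ.differentiable x y

theorem StronglyConvexSmooth.upper {n : ℕ} {m L : ℝ} {φ : Euc n → ℝ}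
    (hφ : StronglyConvexSmooth m L φ) (x y : Euc n) :
    φ y ≤ φ x + ⟪gradient φ x, y - x⟫ + L / 2 * ‖y - x‖ ^ 2 :=
  le_add_inner_gradient_add_of_lipschitz hφ.differentiable hφ.lipschitz x y

/-- The quadratic lower and upper bounds are compared at a nonzero vector, so dimension zero has to
be excluded. -/
theorem StronglyConvexSmooth.le_of_pos {n : ℕ} {m L : ℝ} {φ : Euc n → ℝ}
    (hφ : StronglyConvexSmooth m L φ) (hn : 0 < n) : m ≤ L := by
  have : Nonempty (Fin n) := ⟨⟨0, hn⟩⟩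
  obtain ⟨y, hy⟩ := exists_ne (0 : Euc n)
  have h := (hφ.lower 0 y).trans (hφ.upper 0 y)
  have hpos : 0 < ‖y - 0‖ ^ 2 := by simpa using pow_pos (norm_pos_iff.2 hy) 2
  by_contra! hlt
  nlinarith

/-- Strong monotonicity and the Lipschitz bound for the gradient pass to the limit in difference
quotients along `z`. The prediction model thus inherits the curvature bounds of the cost. -/
theorem StronglyConvexSmooth.inner_fderiv_gradient_mem {n : ℕ} {m L : ℝ} {φ : Euc n → ℝ}
    (hφ : StronglyConvexSmooth m L φ) {x : Euc n} (hx : DifferentiableAt ℝ (gradient φ) x)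
    (z : Euc n) :
    m * ‖z‖ ^ 2 ≤ ⟪z, fderiv ℝ (gradient φ) x z⟫ ∧
      ⟪z, fderiv ℝ (gradient φ) x z⟫ ≤ L * ‖z‖ ^ 2 := by
  have hline : HasDerivAt (fun s : ℝ => ⟪z, gradient φ (x + s • z)⟫)
      ⟪z, fderiv ℝ (gradient φ) x z⟫ 0 := by
    have h1 : HasDerivAt (fun s : ℝ => x + s • z) z 0 := by
      simpa using ((hasDerivAt_id (0 : ℝ)).smul_const z).const_add x
    have h2 : HasFDerivAt (gradient φ) (fderiv ℝ (gradient φ) x) (x + (0 : ℝ) • z) := by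
      simpa using hx.hasFDerivAt
    have h3 := h2.comp_hasDerivAt (0 : ℝ) h1
    simpa [Function.comp_def] using (hasDerivAt_const (0 : ℝ) z).inner ℝ h3
  have hslope := hline.tendsto_slope_zero_right
  constructor
  · refine ge_of_tendsto hslope ?_
    filter_upwards [self_mem_nhdsWithin] with s hs
    have hs : 0 < s := hs
    have h1 := hφ.lower x (x + s • z)
    have h2 := hφ.lower (x + s • z) x
    have e : x - (x + s • z) = -(s • z) := by abel
    rw [add_sub_cancel_left, inner_smul_right, norm_smul, Real.norm_eq_abs, mul_pow, sq_abs,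
      real_inner_comm] at h1
    rw [e, inner_neg_right, inner_smul_right, norm_neg, norm_smul, Real.norm_eq_abs, mul_pow,
      sq_abs, real_inner_comm] at h2
    simp only [smul_eq_mul, zero_add, zero_smul, add_zero]
    rw [le_inv_mul_iff₀ hs]
    refine le_of_mul_le_mul_left ?_ hs
    linarith
  · refine le_of_tendsto hslope ?_
    filter_upwards [self_mem_nhdsWithin] with s hs
    have hs : 0 < s := hs
    have h1 := hφ.lipschitz (x + s • z) x
    rw [add_sub_cancel_left, norm_smul, Real.norm_eq_abs, abs_of_pos hs] at h1
    have h2 := real_inner_le_norm z (gradient φ (x + s • z) - gradient φ x)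
    rw [inner_sub_right] at h2
    simp only [smul_eq_mul, zero_add, zero_smul, add_zero]
    rw [inv_mul_le_iff₀ hs]
    nlinarith [mul_le_mul_of_nonneg_left h1 (norm_nonneg z)]

theorem inner_fderiv_gradient_comm {n : ℕ} {φ : Euc n → ℝ} (hd : Differentiable ℝ φ) {x : Euc n}
    (hx : DifferentiableAt ℝ (gradient φ) x) (u v : Euc n) :
    ⟪fderiv ℝ (gradient φ) x u, v⟫ = ⟪fderiv ℝ (gradient φ) x v, u⟫ := by
  let J : Euc n →L[ℝ] (Euc n →L[ℝ] ℝ) := innerSL ℝ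
  have h1 : ∀ y, HasFDerivAt φ (J (gradient φ y)) y := fun y => by
    have h := (hd y).hasGradientAt.hasFDerivAt
    exact h
  have h2 : HasFDerivAt (fun y => J (gradient φ y)) (J.comp (fderiv ℝ (gradient φ) x)) x :=
    J.hasFDerivAt.comp x hx.hasFDerivAt
  exact second_derivative_symmetric h1 h2 u v

/-- Functions whose gradients differ by at most `c` have increments differing by `c ‖y - x‖`. -/
theorem sub_sub_sub_le_of_norm_gradient_sub_le {n : ℕ} {φ ψ : Euc n → ℝ} {c : ℝ}
    (hφ : Differentiable ℝ φ) (hψ : Differentiable ℝ ψ)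
    (h : ∀ z, ‖gradient φ z - gradient ψ z‖ ≤ c) (x y : Euc n) :
    (φ y - φ x) - (ψ y - ψ x) ≤ c * ‖y - x‖ := by
  have hb : ∀ z ∈ (univ : Set (Euc n)), ‖fderiv ℝ (φ - ψ) z‖ ≤ c := by
    intro z _
    rw [fderiv_sub (hφ z) (hψ z), ← toDual_gradient, ← toDual_gradient, ← map_sub,
      LinearIsometryEquiv.norm_map]
    exact h z
  have h1 := convex_univ.norm_image_sub_le_of_norm_fderiv_le
    (fun z _ => (hφ.sub hψ) z) hb (mem_univ x) (mem_univ y)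
  have h2 := (le_abs_self _).trans h1
  simp only [Pi.sub_apply] at h2
  linarith

/-! ### Minimization of a strongly convex function plus `g` -/

namespace ClosedProperConvex

variable {n : ℕ} {g : Euc n → EReal}

theorem coe_toReal (hg : ClosedProperConvex g) {x : Euc n} (hx : g x ≠ ⊤) :
    ((g x).toReal : EReal) = g x :=
  EReal.coe_toReal hx (hg.ne_bot x)

theorem combo (hg : ClosedProperConvex g) {x y : Euc n} (hx : g x ≠ ⊤) (hy : g y ≠ ⊤)
    {a b : ℝ} (ha : 0 ≤ a) (hb : 0 ≤ b) (hab : a + b = 1) :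
    g (a • x + b • y) ≠ ⊤ ∧
      (g (a • x + b • y)).toReal ≤ a * (g x).toReal + b * (g y).toReal := by
  have h := hg.convex (x := (x, (g x).toReal)) (hg.coe_toReal hx).ge
    (y := (y, (g y).toReal)) (hg.coe_toReal hy).ge ha hb hab
  have h' : g (a • x + b • y) ≤ ((a * (g x).toReal + b * (g y).toReal : ℝ) : EReal) := h
  have htop : g (a • x + b • y) ≠ ⊤ := (h'.trans_lt (EReal.coe_lt_top _)).ne
  refine ⟨htop, ?_⟩
  rw [← hg.coe_toReal htop] at h'
  exact_mod_cast h'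

theorem lineMap (hg : ClosedProperConvex g) {x y : Euc n} (hx : g x ≠ ⊤) (hy : g y ≠ ⊤)
    {θ : ℝ} (h0 : 0 ≤ θ) (h1 : θ ≤ 1) :
    g (x + θ • (y - x)) ≠ ⊤ ∧
      (g (x + θ • (y - x))).toReal ≤ (1 - θ) * (g x).toReal + θ * (g y).toReal := by
  have h := hg.combo hx hy (sub_nonneg.2 h1) h0 (by ring)
  have e : (1 - θ) • x + θ • y = x + θ • (y - x) := by module
  rwa [e] at h

theorem lowerSemicontinuous (hg : ClosedProperConvex g) : LowerSemicontinuous g := by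
  rw [lowerSemicontinuous_iff_isClosed_preimage]
  intro a
  induction a with
  | bot =>
    convert isClosed_empty
    ext x
    simpa using hg.ne_bot x
  | coe a => exact hg.closed a
  | top => simp

/-- Real-valued form of minimality over the effective domain. -/
theorem isMinimizer_iff (hg : ClosedProperConvex g) {φ : Euc n → ℝ} {p : Euc n} :
    IsMinimizer φ g p ↔
      g p ≠ ⊤ ∧ ∀ y, g y ≠ ⊤ → φ p + (g p).toReal ≤ φ y + (g y).toReal := by
  constructor
  · intro h
    obtain ⟨x₀, hx₀⟩ := hg.exists_ne_top
    have hp : g p ≠ ⊤ := by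
      intro hp
      have h0 := h x₀
      rw [hp, EReal.coe_add_top, ← hg.coe_toReal hx₀, ← EReal.coe_add, top_le_iff] at h0
      exact EReal.coe_ne_top _ h0
    refine ⟨hp, fun y hy => ?_⟩
    have h0 := h y
    rw [← hg.coe_toReal hp, ← hg.coe_toReal hy] at h0
    exact_mod_cast h0
  · rintro ⟨hp, h⟩ y
    by_cases hy : g y = ⊤
    · rw [hy, EReal.coe_add_top]
      exact le_top
    · have h0 := h y hy
      rw [← hg.coe_toReal hp, ← hg.coe_toReal hy]
      exact_mod_cast h0

/-- Minimality is tested at `(1 - s) p + s y`; dividing the strong convexity inequality by `s` and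
letting `s → 0` leaves the quadratic term. -/
theorem growth (hg : ClosedProperConvex g) {φ : Euc n → ℝ} {m : ℝ}
    (hφ : StrongConvexOn univ m φ) {p y : Euc n} (hp : IsMinimizer φ g p) (hy : g y ≠ ⊤) :
    φ p + (g p).toReal + m / 2 * ‖y - p‖ ^ 2 ≤ φ y + (g y).toReal := by
  obtain ⟨hpt, hmin⟩ := hg.isMinimizer_iff.1 hp
  have hlim : Tendsto (fun s : ℝ => φ p + (g p).toReal + m / 2 * (1 - s) * ‖y - p‖ ^ 2)
      (nhdsWithin 0 (Ioi 0))
      (nhds (φ p + (g p).toReal + m / 2 * (1 - 0) * ‖y - p‖ ^ 2)) :=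
    (Continuous.tendsto (by fun_prop) 0).mono_left nhdsWithin_le_nhds
  rw [sub_zero, mul_one] at hlim
  refine le_of_tendsto hlim ?_
  filter_upwards [Ioo_mem_nhdsGT (zero_lt_one' ℝ)] with s hs
  obtain ⟨hz, hgz⟩ := hg.combo hpt hy (sub_nonneg.2 hs.2.le) hs.1.le (by ring)
  have h1 := hφ.2 (mem_univ p) (mem_univ y) (sub_nonneg.2 hs.2.le) hs.1.le (by ring)
  have h2 := hmin _ hz
  rw [norm_sub_rev p y] at h1
  simp only [smul_eq_mul] at h1
  refine le_of_mul_le_mul_left ?_ hs.1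
  linarith

theorem minimizer_unique (hg : ClosedProperConvex g) {φ : Euc n → ℝ} {m : ℝ} (hm : 0 < m)
    (hφ : StrongConvexOn univ m φ) {p q : Euc n} (hp : IsMinimizer φ g p)
    (hq : IsMinimizer φ g q) : q = p := by
  have h1 := hg.growth hφ hp (hg.isMinimizer_iff.1 hq).1
  have h2 := (hg.isMinimizer_iff.1 hq).2 p (hg.isMinimizer_iff.1 hp).1
  have h3 : ‖q - p‖ ^ 2 = 0 := by
    have := sq_nonneg ‖q - p‖
    nlinarith
  simpa [sub_eq_zero] using h3

/-- Coercivity comes from strong convexity alone: a minimum over a unit ball around a point of the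
domain bounds the cost from below where a ray to `y` leaves the ball. This forces the sublevel set
into a larger ball, which is compact. -/
theorem exists_minimizer (hg : ClosedProperConvex g) {φ : Euc n → ℝ} {m : ℝ} (hm : 0 < m)
    (hφ : StrongConvexOn univ m φ) (hc : Continuous φ) : ∃ p, IsMinimizer φ g p := by
  have hlsc : LowerSemicontinuous fun y => (φ y : EReal) + g y := by
    refine LowerSemicontinuous.add' (continuous_coe_real_ereal.comp hc).lowerSemicontinuous
      hg.lowerSemicontinuous fun x => ?_
    exact EReal.continuousAt_add (Or.inl (EReal.coe_ne_top _)) (Or.inl (EReal.coe_ne_bot _))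
  obtain ⟨x₀, hx₀⟩ := hg.exists_ne_top
  obtain ⟨q, hqmem, hq⟩ := LowerSemicontinuousOn.exists_isMinOn
    (Metric.nonempty_closedBall.2 zero_le_one) (isCompact_closedBall x₀ 1)
    (hlsc.lowerSemicontinuousOn _)
  rw [isMinOn_iff] at hq
  have hqt : g q ≠ ⊤ := by
    intro hqt
    have h0 := hq x₀ (Metric.mem_closedBall_self zero_le_one)
    rw [hqt, EReal.coe_add_top, ← hg.coe_toReal hx₀, ← EReal.coe_add, top_le_iff] at h0
    exact EReal.coe_ne_top _ h0
  have hqr : ∀ z, ‖z - x₀‖ ≤ 1 → g z ≠ ⊤ →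
      φ q + (g q).toReal ≤ φ z + (g z).toReal := by
    intro z hz hzt
    have h0 := hq z (by rwa [Metric.mem_closedBall, dist_eq_norm])
    rw [← hg.coe_toReal hqt, ← hg.coe_toReal hzt] at h0
    exact_mod_cast h0
  set F₀ := φ x₀ + (g x₀).toReal with hF₀
  set c := φ q + (g q).toReal with hcdef
  have hcF : c ≤ F₀ := hqr x₀ (by simp) hx₀
  set R := 1 + 2 * (F₀ - c) / m with hR
  have hR1 : 1 ≤ R := by
    have : 0 ≤ 2 * (F₀ - c) / m := by
      apply div_nonneg _ hm.le
      linarith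
    linarith
  have hfar : ∀ y, g y ≠ ⊤ → φ y + (g y).toReal ≤ F₀ → ‖y - x₀‖ ≤ R := by
    intro y hy hyF
    by_contra! hlt
    have hr : 1 < ‖y - x₀‖ := hR1.trans_lt hlt
    set r := ‖y - x₀‖ with hrdef
    have hr0 : 0 < r := zero_lt_one.trans hr
    have hs1 : r⁻¹ ≤ 1 := inv_le_one_of_one_le₀ hr.le
    have hs0 : 0 < r⁻¹ := inv_pos.2 hr0
    obtain ⟨hz, hgz⟩ := hg.combo hx₀ hy (sub_nonneg.2 hs1) hs0.le (by ring)
    have h1 := hφ.2 (mem_univ x₀) (mem_univ y) (sub_nonneg.2 hs1) hs0.le (by ring)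
    have h2 := hqr _ (by
      have e : (1 - r⁻¹) • x₀ + r⁻¹ • y - x₀ = r⁻¹ • (y - x₀) := by module
      rw [e, norm_smul, Real.norm_eq_abs, abs_of_pos hs0, ← hrdef, inv_mul_cancel₀ hr0.ne']) hz
    rw [norm_sub_rev x₀ y, ← hrdef] at h1
    simp only [smul_eq_mul] at h1
    have e : (1 - r⁻¹) * r⁻¹ * (m / 2 * r ^ 2) = m / 2 * (r - 1) := by
      field_simp
    rw [e] at h1
    have h3 := mul_le_mul_of_nonneg_left hyF hs0.le
    have h4 : m / 2 * (r - 1) ≤ F₀ - c := by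
      rw [hF₀] at h3 ⊢
      linarith
    have h5 : r - 1 ≤ 2 * (F₀ - c) / m := by
      rw [le_div_iff₀ hm]
      linarith
    linarith
  obtain ⟨p, hpmem, hp⟩ := LowerSemicontinuousOn.exists_isMinOn
    (Metric.nonempty_closedBall.2 (zero_le_one.trans hR1)) (isCompact_closedBall x₀ R)
    (hlsc.lowerSemicontinuousOn _)
  rw [isMinOn_iff] at hp
  have hp0 := hp x₀ (Metric.mem_closedBall_self (zero_le_one.trans hR1))
  refine ⟨p, fun y => ?_⟩
  by_cases hy : g y = ⊤
  · rw [hy, EReal.coe_add_top]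
    exact le_top
  by_cases hyF : φ y + (g y).toReal ≤ F₀
  · exact hp y (by simpa [dist_eq_norm] using hfar y hy hyF)
  · refine hp0.trans ?_
    rw [← hg.coe_toReal hx₀, ← hg.coe_toReal hy]
    exact_mod_cast (not_le.1 hyF).le

/-! ### Quasi-Newton steps and decrease of the composite cost -/

/-- A quasi-Newton step is at least as good as any value of the forward-backward model at the
current point. -/
theorem quasiNewtonStep_le (hg : ClosedProperConvex g) {φ : Euc n → ℝ} {γ : ℝ} (hγ : 0 < γ)
    (hup : ∀ x y, φ y ≤ φ x + ⟪gradient φ x, y - x⟫ + ‖y - x‖ ^ 2 / (2 * γ))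
    {x x' : Euc n} (h : QuasiNewtonStep φ g γ x x') :
    g x' ≠ ⊤ ∧ ∀ y, g y ≠ ⊤ → φ x' + (g x').toReal ≤
      φ x + ⟪gradient φ x, y - x⟫ + ‖y - x‖ ^ 2 / (2 * γ) + (g y).toReal := by
  obtain ⟨_, _, _, w, _, _, _, hle, hprox⟩ := h
  obtain ⟨hx', hmin⟩ := hg.isMinimizer_iff.1 hprox
  refine ⟨hx', fun y hy => ?_⟩
  have hsq : ∀ u, ‖u - (w - γ • gradient φ w)‖ ^ 2 / (2 * γ) =
      ‖u - w‖ ^ 2 / (2 * γ) + ⟪gradient φ w, u - w⟫ + γ / 2 * ‖gradient φ w‖ ^ 2 := by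
    intro u
    have e : u - (w - γ • gradient φ w) = (u - w) + γ • gradient φ w := by abel
    rw [e, norm_add_sq_real, inner_smul_right, norm_smul, mul_pow, Real.norm_eq_abs, sq_abs,
      real_inner_comm]
    field_simp
  -- Completing the square, the proximal objective is the model at `w` up to a constant, so `x'`
  -- minimizes that model, which majorizes the cost.
  have h1 : ((φ x' + (g x').toReal : ℝ) : EReal) ≤ fbe φ g γ w := by
    refine le_iInf fun u => ?_
    by_cases hu : g u = ⊤
    · rw [hu, EReal.coe_add_top]
      exact le_top
    · rw [← hg.coe_toReal hu, ← EReal.coe_add, EReal.coe_le_coe_iff]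
      have h2 := hmin u hu
      simp only [hsq] at h2
      linarith [hup w x']
  have h2 : fbe φ g γ x ≤
      ((φ x + ⟪gradient φ x, y - x⟫ + ‖y - x‖ ^ 2 / (2 * γ) : ℝ) : EReal) + g y := iInf_le _ y
  have h3 := (h1.trans hle).trans h2
  rw [← hg.coe_toReal hy] at h3
  exact_mod_cast h3

/-- Each quasi-Newton step does not increase the composite cost. -/
theorem quasiNewtonSteps_le (hg : ClosedProperConvex g) {φ : Euc n → ℝ} {γ : ℝ} (hγ : 0 < γ)
    (hup : ∀ x y, φ y ≤ φ x + ⟪gradient φ x, y - x⟫ + ‖y - x‖ ^ 2 / (2 * γ))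
    {N : ℕ} {x x' : Euc n} (hx : g x ≠ ⊤) (h : QuasiNewtonSteps φ g γ N x x') :
    g x' ≠ ⊤ ∧ φ x' + (g x').toReal ≤ φ x + (g x).toReal := by
  obtain ⟨u, rfl, rfl, hu⟩ := h
  have key : ∀ i ≤ N, g (u i) ≠ ⊤ ∧ φ (u i) + (g (u i)).toReal ≤ φ (u 0) + (g (u 0)).toReal := by
    intro i
    induction i with
    | zero => exact fun _ => ⟨hx, le_rfl⟩
    | succ i ih =>
      intro hi
      obtain ⟨h1, h2⟩ := ih (Nat.le_of_succ_le hi)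
      obtain ⟨h3, h4⟩ := hg.quasiNewtonStep_le hγ hup (hu i hi)
      refine ⟨h3, ?_⟩
      have h5 := h4 (u i) h1
      simp at h5
      linarith
  exact key N le_rfl

/-- Linear decrease of the cost gap with respect to any reference point of the domain. -/
theorem quasiNewtonStep_gap_le (hg : ClosedProperConvex g) {φ : Euc n → ℝ} {γ m : ℝ} (hγ : 0 < γ)
    (hm : 0 < m) (hγm : γ * m ≤ 1)
    (hup : ∀ x y, φ y ≤ φ x + ⟪gradient φ x, y - x⟫ + ‖y - x‖ ^ 2 / (2 * γ))
    (hlow : ∀ x y, φ x + ⟪gradient φ x, y - x⟫ + m / 2 * ‖y - x‖ ^ 2 ≤ φ y)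
    {x x' p : Euc n} (hx : g x ≠ ⊤) (hp : g p ≠ ⊤) (h : QuasiNewtonStep φ g γ x x') :
    φ x' + (g x').toReal - (φ p + (g p).toReal) ≤
      (1 - γ * m) * (φ x + (g x).toReal - (φ p + (g p).toReal)) := by
  -- At the trial point `x + γ m (p - x)` the proximal term is exactly `γ m` times the strong
  -- convexity term, so the two cancel.
  obtain ⟨hz, hgz⟩ := hg.lineMap hx hp (mul_pos hγ hm).le hγm
  have h1 := (hg.quasiNewtonStep_le hγ hup h).2 _ hz
  rw [add_sub_cancel_left, inner_smul_right, norm_smul, mul_pow, Real.norm_eq_abs, sq_abs] at h1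
  have e : (γ * m) ^ 2 * ‖p - x‖ ^ 2 / (2 * γ) = γ * m * (m / 2 * ‖p - x‖ ^ 2) := by
    field_simp
  rw [e] at h1
  have h2 := mul_le_mul_of_nonneg_left (hlow x p) (mul_pos hγ hm).le
  linarith

theorem quasiNewtonSteps_gap_le (hg : ClosedProperConvex g) {φ : Euc n → ℝ} {γ m : ℝ}
    (hγ : 0 < γ) (hm : 0 < m) (hγm : γ * m ≤ 1)
    (hup : ∀ x y, φ y ≤ φ x + ⟪gradient φ x, y - x⟫ + ‖y - x‖ ^ 2 / (2 * γ))
    (hlow : ∀ x y, φ x + ⟪gradient φ x, y - x⟫ + m / 2 * ‖y - x‖ ^ 2 ≤ φ y)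
    {N : ℕ} {x x' p : Euc n} (hx : g x ≠ ⊤) (hp : g p ≠ ⊤)
    (h : QuasiNewtonSteps φ g γ N x x') :
    φ x' + (g x').toReal - (φ p + (g p).toReal) ≤
      (1 - γ * m) ^ N * (φ x + (g x).toReal - (φ p + (g p).toReal)) := by
  obtain ⟨u, rfl, rfl, hu⟩ := h
  have key : ∀ i ≤ N, g (u i) ≠ ⊤ ∧ φ (u i) + (g (u i)).toReal - (φ p + (g p).toReal) ≤
      (1 - γ * m) ^ i * (φ (u 0) + (g (u 0)).toReal - (φ p + (g p).toReal)) := by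
    intro i
    induction i with
    | zero => exact fun _ => ⟨hx, by simp⟩
    | succ i ih =>
      intro hi
      obtain ⟨h1, h2⟩ := ih (Nat.le_of_succ_le hi)
      refine ⟨(hg.quasiNewtonStep_le hγ hup (hu i hi)).1, ?_⟩
      have h3 := hg.quasiNewtonStep_gap_le hγ hm hγm hup hlow h1 hp (hu i hi)
      have h4 := mul_le_mul_of_nonneg_left h2 (sub_nonneg.2 hγm)
      rw [pow_succ']
      linarith
  exact (key N le_rfl).2

theorem quasiNewtonSteps_ne_top (hg : ClosedProperConvex g) {φ : Euc n → ℝ} {γ : ℝ} (hγ : 0 < γ)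
    (hup : ∀ x y, φ y ≤ φ x + ⟪gradient φ x, y - x⟫ + ‖y - x‖ ^ 2 / (2 * γ))
    {N : ℕ} {x x' : Euc n} (hN : N ≠ 0) (h : QuasiNewtonSteps φ g γ N x x') : g x' ≠ ⊤ := by
  obtain ⟨u, rfl, rfl, hu⟩ := h
  obtain ⟨i, rfl⟩ := Nat.exists_eq_succ_of_ne_zero hN
  exact (hg.quasiNewtonStep_le hγ hup (hu i (Nat.lt_succ_self i))).1

/-- The decrease of the first-order model is controlled by the cost gap. -/
theorem neg_gap_le_model (hg : ClosedProperConvex g) {φ : Euc n → ℝ} {m L : ℝ}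
    (hm : 0 < m) (hmL : m ≤ L) (hφ : StronglyConvexSmooth m L φ) {x y p : Euc n}
    (hx : g x ≠ ⊤) (hy : g y ≠ ⊤) (hp : IsMinimizer φ g p) :
    -(2 * L / m * (φ x + (g x).toReal - (φ p + (g p).toReal))) ≤
      ⟪gradient φ x, y - x⟫ + ((g y).toReal - (g x).toReal) + m / 4 * ‖y - x‖ ^ 2 := by
  have hL : 0 < L := hm.trans_le hmL
  -- A fraction `m / (2 L)` of the way from `x` to `y` reduces the smoothness term to `m / 4`, half
  -- the curvature available in the prediction estimate.
  have hθ : 0 < m / (2 * L) := by positivity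
  obtain ⟨hz, hgz⟩ := hg.lineMap hx hy hθ.le (by rw [div_le_one (by positivity)]; linarith)
  have h1 := (hg.isMinimizer_iff.1 hp).2 _ hz
  have h2 := hφ.upper x (x + (m / (2 * L)) • (y - x))
  rw [add_sub_cancel_left, inner_smul_right, norm_smul, mul_pow, Real.norm_eq_abs, sq_abs] at h2
  have e : L / 2 * ((m / (2 * L)) ^ 2 * ‖y - x‖ ^ 2) =
      m / (2 * L) * (m / 4 * ‖y - x‖ ^ 2) := by
    field_simp
    ring
  rw [e] at h2
  refine le_of_mul_le_mul_left ?_ hθ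
  have e' : m / (2 * L) * -(2 * L / m * (φ x + (g x).toReal - (φ p + (g p).toReal))) =
      -(φ x + (g x).toReal - (φ p + (g p).toReal)) := by
    field_simp
  rw [e']
  linarith

end ClosedProperConvex

/-! ### Time drift and the prediction model -/

theorem CostAssumptions.nonneg {n : ℕ} {m L C₀ : ℝ} {f : Euc n → ℝ → ℝ}
    (hf : CostAssumptions m L C₀ f) : 0 ≤ C₀ :=
  (norm_nonneg _).trans (hf.norm_gradTX_le 0 0 le_rfl)

theorem CostAssumptions.norm_gradX_sub_le {n : ℕ} {m L C₀ : ℝ} {f : Euc n → ℝ → ℝ}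
    (hf : CostAssumptions m L C₀ f) (x : Euc n) {s t : ℝ} (hs : 0 ≤ s) (ht : 0 ≤ t) :
    ‖gradX f x t - gradX f x s‖ ≤ C₀ * |t - s| :=
  (convex_Ici (0 : ℝ)).norm_image_sub_le_of_norm_derivWithin_le (hf.differentiableOn_time x)
    (fun u hu => hf.norm_gradTX_le x u hu) hs ht

theorem CostAssumptions.hessX_comm {n : ℕ} {m L C₀ : ℝ} {f : Euc n → ℝ → ℝ}
    (hf : CostAssumptions m L C₀ f) (z : Euc n) {t : ℝ} (ht : 0 ≤ t) (u v : Euc n) :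
    ⟪hessX f z t u, v⟫ = ⟪hessX f z t v, u⟫ :=
  inner_fderiv_gradient_comm (hf.stronglyConvexSmooth t ht).differentiable
    (hf.differentiable_gradX t ht z) u v

theorem gradient_predModel {n : ℕ} {f : Euc n → ℝ → ℝ} {Ts t : ℝ} {z : Euc n}
    (hsymm : ∀ u v, ⟪hessX f z t u, v⟫ = ⟪hessX f z t v, u⟫) (x : Euc n) :
    gradient (predModel f Ts z t) x =
      hessX f z t x + (gradX f z t - hessX f z t z + Ts • gradTX f z t) := by
  apply HasGradientAt.gradient
  rw [hasGradientAt_iff_hasFDerivAt]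
  have h1 := (((hasFDerivAt_id x).inner ℝ (hessX f z t).hasFDerivAt).const_mul (1 / 2)).add
    ((hasFDerivAt_const (gradX f z t - hessX f z t z + Ts • gradTX f z t) x).inner ℝ
      (hasFDerivAt_id x))
  refine HasFDerivAt.congr_fderiv h1 ?_
  ext v
  have h2 := hsymm v x
  have h3 := real_inner_comm x (hessX f z t v)
  have h4 := real_inner_comm v (hessX f z t x)
  simp [inner_add_left, inner_sub_left, inner_smul_left]
  linarith

/-- The Taylor expansion of a quadratic is exact, so the curvature bounds on the Hessian give the
descent inequality for the prediction model. -/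
theorem predModel_eq {n : ℕ} {f : Euc n → ℝ → ℝ} {Ts t : ℝ} {z : Euc n}
    (hsymm : ∀ u v, ⟪hessX f z t u, v⟫ = ⟪hessX f z t v, u⟫) (x y : Euc n) :
    predModel f Ts z t y = predModel f Ts z t x + ⟪gradient (predModel f Ts z t) x, y - x⟫
      + 1 / 2 * ⟪y - x, hessX f z t (y - x)⟫ := by
  rw [gradient_predModel hsymm]
  simp only [predModel, map_sub, inner_sub_left, inner_sub_right, inner_add_left]
  have h1 := hsymm x y
  have h2 := real_inner_comm y (hessX f z t x)
  have h3 := real_inner_comm x (hessX f z t y)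
  have h4 := real_inner_comm x (hessX f z t x)
  linarith

/-- Suboptimality for the next cost of a point which decreases the prediction model, in terms of
the suboptimality of the current point for the current cost. -/
theorem ClosedProperConvex.prediction_gap_le {n : ℕ} {g : Euc n → EReal}
    (hg : ClosedProperConvex g) {m L c : ℝ} (hm : 0 < m) (hmL : m ≤ L)
    {φ ψ : Euc n → ℝ} (hφ : StronglyConvexSmooth m L φ) (hψ : StronglyConvexSmooth m L ψ)
    (hφψ : ∀ z, ‖gradient ψ z - gradient φ z‖ ≤ c) {x y p q : Euc n}
    (hx : g x ≠ ⊤) (hy : g y ≠ ⊤) (hp : IsMinimizer φ g p) (hq : IsMinimizer ψ g q)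
    (hxy : ⟪gradient φ x, y - x⟫ + ((g y).toReal - (g x).toReal) + m / 2 * ‖y - x‖ ^ 2 ≤
      c * ‖y - x‖) :
    ψ y + (g y).toReal - (ψ q + (g q).toReal) ≤
      18 * (L / m) ^ 2 * (φ x + (g x).toReal - (φ p + (g p).toReal))
        + 20 * (L / m) * (c ^ 2 / m) := by
  obtain ⟨κ, hκ⟩ : ∃ κ, κ = L / m := ⟨_, rfl⟩
  have hLκ : L = κ * m := by rw [hκ]; field_simp
  have hκ1 : 1 ≤ κ := by rw [hκ, le_div_iff₀ hm]; linarith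
  obtain ⟨D, hD⟩ : ∃ D, D = c ^ 2 / m := ⟨_, rfl⟩
  have hDm : c ^ 2 = D * m := by rw [hD]; field_simp
  have hD0 : 0 ≤ D := by rw [hD]; positivity
  have hmodel := hg.neg_gap_le_model hm hmL hφ hx hy hp
  have hupper := hφ.upper x y
  have hV := (hg.isMinimizer_iff.1 hp).2 x hx
  have hpq := (hg.isMinimizer_iff.1 hp).2 q (hg.isMinimizer_iff.1 hq).1
  have hgrow := hg.growth hψ.strongConvex hq hy
  have hinc := sub_sub_sub_le_of_norm_gradient_sub_le hψ.differentiable hφ.differentiable hφψ q y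
  have e : 2 * L / m = 2 * κ := by rw [hκ]; ring
  rw [e] at hmodel
  rw [← hκ, ← hD]
  have young : ∀ a r : ℝ, 0 < a → c * r ≤ a * m * r ^ 2 + D / (4 * a) := by
    intro a r ha
    have h1 : 0 ≤ (2 * a * m * r - c) ^ 2 / (4 * a * m) := by positivity
    have h2 : (2 * a * m * r - c) ^ 2 / (4 * a * m) = a * m * r ^ 2 - c * r + D / (4 * a) := by
      rw [hD]
      field_simp
      ring
    linarith
  set r := ‖y - x‖
  set ρ := ‖y - q‖
  set V := φ x + (g x).toReal - (φ p + (g p).toReal) with hVdef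
  have hV0 : 0 ≤ V := by linarith
  -- The model bound consumes `m/4` of the curvature `m/2`; Young's inequality with weight `1/8`
  -- spends half of the rest.
  have hmr : m * r ^ 2 ≤ 16 * κ * V + 16 * D := by
    have := young (1 / 8) r (by norm_num)
    norm_num at this
    linarith
  have hW : φ y + (g y).toReal - (φ p + (g p).toReal) ≤ V + κ / 2 * (m * r ^ 2) + D / 2 := by
    have := young (1 / 2) r (by norm_num)
    norm_num at this
    rw [hLκ] at hupper
    linarith
  -- The drift `c ρ` is absorbed using the growth of `ψ + g` around `q`: weight `1/4` costs half of
  -- the left side, hence the factor 2.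
  have hU : ψ y + (g y).toReal - (ψ q + (g q).toReal) ≤
      2 * (φ y + (g y).toReal - (φ p + (g p).toReal)) + 2 * D := by
    have := young (1 / 4) ρ (by norm_num)
    norm_num at this
    linarith
  have h1 := mul_le_mul_of_nonneg_left hmr (by positivity : 0 ≤ κ / 2)
  have h2 : V ≤ κ ^ 2 * V := le_mul_of_one_le_left hV0 (one_le_pow₀ hκ1)
  have h3 : D ≤ κ * D := le_mul_of_one_le_left hD0 hκ1
  nlinarith

/-! ### The rate and scalar recursions -/

theorem rateZeta_nonneg (m L γ : ℝ) : 0 ≤ rateZeta m L γ := Real.sqrt_nonneg _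

theorem one_sub_le_rateZeta_pow {m L γ : ℝ} (hm : 0 < m) (hγm : γ * m ≤ 1) :
    1 - γ * m ≤ rateZeta m L γ ^ 8 := by
  have h1 : 0 ≤ 1 - m / 4 * γ := by linarith
  have h2 : 1 - m / 4 * γ ≤ max (1 / 2) (1 - m / 4 * min γ (1 / (4 * L))) := by
    refine le_trans ?_ (le_max_right _ _)
    have := mul_le_mul_of_nonneg_left (min_le_left γ (1 / (4 * L))) (by positivity : 0 ≤ m / 4)
    linarith
  have h3 : rateZeta m L γ ^ 8 = (max (1 / 2) (1 - m / 4 * min γ (1 / (4 * L)))) ^ 4 := by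
    rw [show (8 : ℕ) = 2 * 4 from rfl, pow_mul, rateZeta, Real.sq_sqrt]
    exact le_trans (by norm_num) (le_max_left _ _)
  rw [h3]
  refine le_trans ?_ (pow_le_pow_left₀ h1 h2 4)
  -- Bernoulli's inequality: `1 - γ m ≤ (1 - γ m / 4)^4`.
  have := one_add_mul_le_pow (a := -(m / 4 * γ)) (by linarith) 4
  norm_num at this
  rw [sub_eq_add_neg 1 (m / 4 * γ)]
  linarith

/-- A real sequence with `V (k+1) ≤ V k / 2 + b` is eventually bounded by about `2 b`. -/
theorem le_geometric_add_of_half_contraction {V : ℕ → ℝ} {b : ℝ}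
    (h : ∀ k, 1 ≤ k → V (k + 1) ≤ V k / 2 + b) (hb : 0 ≤ b) {k : ℕ} (hk : 1 ≤ k) :
    V k ≤ (1 / 2) ^ k * (2 * V 1) + 2 * b := by
  induction k, hk using Nat.le_induction with
  | base => linarith
  | succ k hk ih =>
    rw [pow_succ]
    linarith [h k hk]

/-- Working in `EReal` makes the limsup monotone without any boundedness condition. -/
theorem limsup_coe_le_of_sq_le {d : ℕ → ℝ} {a e : ℝ} (he : 0 ≤ e)
    (h : ∀ k, 1 ≤ k → d k ^ 2 ≤ (1 / 2) ^ k * a + e ^ 2) :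
    limsup (fun k => (d k : EReal)) atTop ≤ (e : EReal) := by
  have h1 : Tendsto (fun k : ℕ => √((1 / 2) ^ k * a + e ^ 2)) atTop (nhds e) := by
    have h0 : Tendsto (fun k : ℕ => (1 / 2 : ℝ) ^ k * a + e ^ 2) atTop (nhds (0 * a + e ^ 2)) :=
      ((tendsto_pow_atTop_nhds_zero_of_lt_one (by norm_num) (by norm_num)).mul_const a).add_const _
    have := (Real.continuous_sqrt.tendsto _).comp h0
    rwa [zero_mul, zero_add, Real.sqrt_sq he] at this
  have h2 := (continuous_coe_real_ereal.tendsto e).comp h1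
  rw [← h2.limsup_eq]
  refine limsup_le_limsup ?_
  filter_upwards [eventually_ge_atTop 1] with k hk
  exact EReal.coe_le_coe_iff.2 (Real.le_sqrt_of_sq_le (h k hk))

/-! ### One iteration and the asymptotic bound -/

/-- One iteration of the prediction-correction method, in terms of cost gaps. -/
theorem prediction_correction_gap_le {n : ℕ} {f : Euc n → ℝ → ℝ} {g : Euc n → EReal}
    {m L γ C₀ Ts s t : ℝ} (hm : 0 < m) (hmL : m ≤ L) (hγ : 0 < γ) (hγL : γ < 1 / L)
    (hf : CostAssumptions m L C₀ f) (hg : ClosedProperConvex g) {P C : ℕ}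
    (hC : rateZeta m L γ ^ C * (2 * L / m) ≤ 1) (hs : 0 ≤ s) (hTs : 0 < Ts) (ht : t = s + Ts)
    {x y x' p q : Euc n} (hx : g x ≠ ⊤) (hp : IsMinimizer (fun z => f z s) g p)
    (hq : IsMinimizer (fun z => f z t) g q)
    (hpred : QuasiNewtonSteps (predModel f Ts x s) g γ P x y)
    (hcorr : QuasiNewtonSteps (fun z => f z t) g γ C y x') :
    f x' t + (g x').toReal - (f q t + (g q).toReal) ≤
      (f x s + (g x).toReal - (f p s + (g p).toReal)) / 2
        + rateZeta m L γ ^ (2 * C) * ((C₀ * Ts) ^ 2 / m) := by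
  have hL : 0 < L := hm.trans_le hmL
  have hγL' : γ * L < 1 := (lt_div_iff₀ hL).1 hγL
  have hγm : γ * m ≤ 1 := (mul_le_mul_of_nonneg_left hmL hγ.le).trans hγL'.le
  have ht0 : 0 ≤ t := by linarith
  have hφ := hf.stronglyConvexSmooth s hs
  have hψ := hf.stronglyConvexSmooth t ht0
  have hsymm := hf.hessX_comm x hs
  have hquad : ∀ r : ℝ, L / 2 * r ^ 2 ≤ r ^ 2 / (2 * γ) := by
    intro r
    rw [le_div_iff₀ (by positivity)]
    nlinarith [sq_nonneg r]
  have hhess := hφ.inner_fderiv_gradient_mem (hf.differentiable_gradX s hs x)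
  have hupH : ∀ u v, predModel f Ts x s v ≤ predModel f Ts x s u
      + ⟪gradient (predModel f Ts x s) u, v - u⟫ + ‖v - u‖ ^ 2 / (2 * γ) := by
    intro u v
    rw [predModel_eq hsymm u v]
    have h1 : ⟪v - u, hessX f x s (v - u)⟫ ≤ L * ‖v - u‖ ^ 2 := (hhess (v - u)).2
    linarith [hquad ‖v - u‖]
  have hupψ : ∀ u v, (fun z => f z t) v ≤ (fun z => f z t) u
      + ⟪gradient (fun z => f z t) u, v - u⟫ + ‖v - u‖ ^ 2 / (2 * γ) := fun u v =>
    (hψ.upper u v).trans (by linarith [hquad ‖v - u‖])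
  obtain ⟨hy, hH⟩ := hg.quasiNewtonSteps_le hγ hupH hx hpred
  have hxy : ⟪gradient (fun z => f z s) x, y - x⟫ + ((g y).toReal - (g x).toReal)
      + m / 2 * ‖y - x‖ ^ 2 ≤ C₀ * Ts * ‖y - x‖ := by
    rw [predModel_eq hsymm x y, gradient_predModel hsymm] at hH
    have e : hessX f x s x + (gradX f x s - hessX f x s x + Ts • gradTX f x s) =
        gradX f x s + Ts • gradTX f x s := by abel
    rw [e, inner_add_left, inner_smul_left] at hH
    have h1 : m * ‖y - x‖ ^ 2 ≤ ⟪y - x, hessX f x s (y - x)⟫ := (hhess (y - x)).1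
    have h2 : -(C₀ * ‖y - x‖) ≤ ⟪gradTX f x s, y - x⟫ := by
      have h3 := neg_le_of_abs_le (abs_real_inner_le_norm (gradTX f x s) (y - x))
      have h4 := mul_le_mul_of_nonneg_right (hf.norm_gradTX_le x s hs) (norm_nonneg (y - x))
      linarith
    have h5 := mul_le_mul_of_nonneg_left h2 hTs.le
    simp only [conj_trivial] at hH
    have h6 : ⟪gradX f x s, y - x⟫ = ⟪gradient (fun z => f z s) x, y - x⟫ := rfl
    linarith
  have hdrift : ∀ z, ‖gradient (fun u => f u t) z - gradient (fun u => f u s) z‖ ≤ C₀ * Ts := by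
    intro z
    have h := hf.norm_gradX_sub_le z hs ht0
    rwa [ht, add_sub_cancel_left, abs_of_pos hTs, ← ht] at h
  have hU := hg.prediction_gap_le hm hmL hφ hψ hdrift hx hy hp hq hxy
  have hcon := hg.quasiNewtonSteps_gap_le hγ hm hγm hupψ hψ.lower hy
    (hg.isMinimizer_iff.1 hq).1 hcorr
  have hUnn := (hg.isMinimizer_iff.1 hq).2 y hy
  have hVnn := (hg.isMinimizer_iff.1 hp).2 x hx
  have hζ0 := rateZeta_nonneg m L γ
  have hrate : (1 - γ * m) ^ C ≤ (rateZeta m L γ ^ C) ^ 8 := by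
    rw [pow_right_comm]
    exact pow_le_pow_left₀ (sub_nonneg.2 hγm) (one_sub_le_rateZeta_pow hm hγm) C
  rw [mul_comm 2 C, pow_mul]
  obtain ⟨Z, hZ⟩ : ∃ Z, Z = rateZeta m L γ ^ C := ⟨_, rfl⟩
  have hZ0 : 0 ≤ Z := by rw [hZ]; positivity
  obtain ⟨κ, hκ⟩ : ∃ κ, κ = L / m := ⟨_, rfl⟩
  have hκ1 : 1 ≤ κ := by rw [hκ, le_div_iff₀ hm]; linarith
  rw [← hκ] at hU
  rw [← hZ] at hrate hC ⊢
  have hZκ : Z * κ ≤ 1 / 2 := by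
    have e : Z * (2 * L / m) = 2 * (Z * κ) := by rw [hκ]; ring
    linarith
  have hZ1 : Z ≤ 1 / 2 := (le_mul_of_one_le_right hZ0 hκ1).trans hZκ
  -- Two of the eight powers of `Z` cancel `κ²`; two more are kept for the error term, and the
  -- remaining four supply the numerical smallness: `18/64 ≤ 1/2` and `20/64 ≤ 1`.
  have hZ6 : Z ^ 6 * κ ^ 2 ≤ 1 / 64 := by
    have h1 : (Z * κ) ^ 2 ≤ (1 / 2) ^ 2 := pow_le_pow_left₀ (by positivity) hZκ 2
    have h2 : Z ^ 4 ≤ (1 / 2) ^ 4 := pow_le_pow_left₀ hZ0 hZ1 4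
    have h3 := mul_le_mul h2 h1 (by positivity) (by positivity)
    calc Z ^ 6 * κ ^ 2 = Z ^ 4 * (Z * κ) ^ 2 := by ring
      _ ≤ _ := h3
      _ = 1 / 64 := by norm_num
  have hZ6' : Z ^ 6 * κ ≤ 1 / 64 :=
    le_trans (mul_le_mul_of_nonneg_left (le_self_pow₀ hκ1 two_ne_zero) (by positivity)) hZ6
  have hZ8 : Z ^ 8 * κ ^ 2 ≤ 1 / 64 :=
    le_trans (mul_le_mul_of_nonneg_right
      (pow_le_pow_of_le_one hZ0 (by linarith) (by norm_num)) (by positivity)) hZ6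
  set V := f x s + (g x).toReal - (f p s + (g p).toReal)
  set E := (C₀ * Ts) ^ 2 / m
  have hV0 : 0 ≤ V := sub_nonneg.2 hVnn
  have hE0 : 0 ≤ E := by positivity
  refine hcon.trans ?_
  refine (mul_le_mul_of_nonneg_right hrate (sub_nonneg.2 hUnn)).trans ?_
  refine (mul_le_mul_of_nonneg_left hU (by positivity)).trans ?_
  have h1 := mul_le_mul_of_nonneg_right hZ8 hV0
  have h2 := mul_le_mul_of_nonneg_right hZ6' (by positivity : 0 ≤ Z ^ 2 * E)
  have h3 : 0 ≤ Z ^ 2 * E := by positivity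
  calc Z ^ 8 * (18 * κ ^ 2 * V + 20 * κ * E)
      = 18 * (Z ^ 8 * κ ^ 2 * V) + 20 * (Z ^ 6 * κ * (Z ^ 2 * E)) := by ring
    _ ≤ V / 2 + Z ^ 2 * E := by linarith

theorem theorem1 (m L γ C₀ : ℝ) (hm : 0 < m) (hγ : 0 < γ) (hγL : γ < 1 / L) :
    ∃ K : ℝ, ∀ (n : ℕ) (f : Euc n → ℝ → ℝ) (g : Euc n → EReal),
      CostAssumptions m L C₀ f → ClosedProperConvex g →
      ∃ xstar : ℝ → Euc n,
        (∀ t, 0 ≤ t → ∀ y, IsMinimizer (fun z => f z t) g y ↔ y = xstar t) ∧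
        ∀ P C : ℕ,
          rateZeta m L γ ^ C * (rateZeta m L γ ^ P + (rateZeta m L γ ^ P + 1) *
            (2 * L / m) * ((1 - γ * m) / (1 - γ * L))) < 1 →
          ∀ (t₀ Ts : ℝ) (x : ℕ → Euc n), 0 ≤ t₀ → 0 < Ts →
            IsPredictionCorrection f g γ P C t₀ Ts x →
            Filter.limsup (fun k : ℕ => ((‖x k - xstar (t₀ + k * Ts)‖ : ℝ) : EReal)) Filter.atTop
              ≤ ((K * rateZeta m L γ ^ C * Ts : ℝ) : EReal) := by
  refine ⟨2 * C₀ / m, fun n f g hf hg => ?_⟩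
  have hL : 0 < L := one_div_pos.1 (hγ.trans hγL)
  have hex : ∀ t, ∃ p, 0 ≤ t → IsMinimizer (fun z => f z t) g p := fun t => by
    by_cases ht : 0 ≤ t
    · have hφ := hf.stronglyConvexSmooth t ht
      obtain ⟨p, hp⟩ := hg.exists_minimizer hm hφ.strongConvex hφ.differentiable.continuous
      exact ⟨p, fun _ => hp⟩
    -- The value at negative times is arbitrary.
    · exact ⟨0, fun h => absurd h ht⟩
  choose xstar hstar using hex
  refine ⟨xstar, fun t ht y => ⟨fun hy => hg.minimizer_unique hm
    (hf.stronglyConvexSmooth t ht).strongConvex (hstar t ht) hy, fun hy => hy ▸ hstar t ht⟩, ?_⟩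
  intro P C hPC t₀ Ts x ht₀ hTs halg
  have hC₀ := hf.nonneg
  have hζ0 := rateZeta_nonneg m L γ
  have hbound : 0 ≤ 2 * C₀ / m * rateZeta m L γ ^ C * Ts := by positivity
  -- In dimension zero `m ≤ L` may fail, but all distances vanish.
  rcases Nat.eq_zero_or_pos n with rfl | hn
  · refine limsup_coe_le_of_sq_le (a := 0) hbound fun k _ => ?_
    rw [Subsingleton.elim (x k) (xstar (t₀ + k * Ts)), sub_self, norm_zero, mul_zero, zero_add,
      zero_pow two_ne_zero]
    exact sq_nonneg _
  have hmL : m ≤ L := (hf.stronglyConvexSmooth 0 le_rfl).le_of_pos hn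
  have hγL' : γ * L < 1 := (lt_div_iff₀ hL).1 hγL
  have hratio : 1 ≤ (1 - γ * m) / (1 - γ * L) := by
    rw [le_div_iff₀ (by linarith)]
    nlinarith
  have hfac : 2 * L / m ≤ rateZeta m L γ ^ P + (rateZeta m L γ ^ P + 1) *
      (2 * L / m) * ((1 - γ * m) / (1 - γ * L)) := by
    have hP : 0 ≤ rateZeta m L γ ^ P := by positivity
    have h0 : 0 ≤ 2 * L / m := by positivity
    have h1 : 2 * L / m ≤ (rateZeta m L γ ^ P + 1) * (2 * L / m) :=
      le_mul_of_one_le_left h0 (by linarith)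
    have h2 := le_mul_of_one_le_right (h0.trans h1) hratio
    linarith
  have hC : rateZeta m L γ ^ C * (2 * L / m) < 1 :=
    (mul_le_mul_of_nonneg_left hfac (by positivity)).trans_lt hPC
  -- Since `2 L / m > 1`, at least one correction step occurs; its proximal operation lands in the
  -- domain of `g`.
  have hC0 : C ≠ 0 := by
    rintro rfl
    rw [pow_zero, one_mul, div_lt_one hm] at hC
    linarith
  have htime : ∀ k : ℕ, 0 ≤ t₀ + k * Ts := fun k => by positivity
  have hdom : ∀ k, 1 ≤ k → g (x k) ≠ ⊤ := by
    intro k hk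
    obtain ⟨j, rfl⟩ := Nat.exists_eq_add_of_le' hk
    obtain ⟨y, -, hcorr⟩ := halg j
    have hψ := hf.stronglyConvexSmooth (t₀ + (j + 1) * Ts) (by positivity)
    refine hg.quasiNewtonSteps_ne_top hγ (fun u v => (hψ.upper u v).trans ?_) hC0 hcorr
    have : L / 2 * ‖v - u‖ ^ 2 ≤ ‖v - u‖ ^ 2 / (2 * γ) := by
      rw [le_div_iff₀ (by positivity)]
      nlinarith [sq_nonneg ‖v - u‖]
    linarith
  set E := rateZeta m L γ ^ (2 * C) * ((C₀ * Ts) ^ 2 / m) with hE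
  have hE0 : 0 ≤ E := by positivity
  set V : ℕ → ℝ := fun k => f (x k) (t₀ + k * Ts) + (g (x k)).toReal
    - (f (xstar (t₀ + k * Ts)) (t₀ + k * Ts) + (g (xstar (t₀ + k * Ts))).toReal) with hV
  -- The recursion starts at 1 because `x 0` may lie outside the domain of `g`, where the gap is
  -- meaningless.
  have hrec : ∀ k, 1 ≤ k → V (k + 1) ≤ V k / 2 + E := by
    intro k hk
    obtain ⟨y, hpred, hcorr⟩ := halg k
    simp only [hV, Nat.cast_add, Nat.cast_one]
    exact prediction_correction_gap_le hm hmL hγ hγL hf hg hC.le (htime k) hTs (by ring)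
      (hdom k hk) (hstar _ (htime k)) (hstar _ (by positivity)) hpred hcorr
  refine limsup_coe_le_of_sq_le (a := 2 / m * (2 * V 1)) hbound fun k hk => ?_
  have h1 := le_geometric_add_of_half_contraction hrec hE0 hk
  have h2 := hg.growth (hf.stronglyConvexSmooth _ (htime k)).strongConvex
    (hstar _ (htime k)) (hdom k hk)
  have h3 : m / 2 * ‖x k - xstar (t₀ + k * Ts)‖ ^ 2 ≤ (1 / 2) ^ k * (2 * V 1) + 2 * E := by
    refine le_trans ?_ h1
    simp only [hV]
    linarith
  have h4 : ‖x k - xstar (t₀ + k * Ts)‖ ^ 2 ≤ 2 / m * ((1 / 2) ^ k * (2 * V 1) + 2 * E) := by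
    have h5 := mul_le_mul_of_nonneg_left h3 (by positivity : 0 ≤ 2 / m)
    have e : 2 / m * (m / 2 * ‖x k - xstar (t₀ + k * Ts)‖ ^ 2) =
        ‖x k - xstar (t₀ + k * Ts)‖ ^ 2 := by field_simp
    rwa [e] at h5
  refine h4.trans (le_of_eq ?_)
  rw [hE, mul_comm 2 C, pow_mul]
  field_simp
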